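/- Setting. An instance consists of a set $N$ of $n$ agents, a budget $B>0$, costs $c_i\in(0,B]$ for $i\in N$, and a valuation $v:2^N\to\mathbb{R}_{\ge 0}$ with $v(\emptyset)=0$; here $v$ is monotone ($v(S)\le v(T)$ for $S\subseteq T$) and submodular ($v(i\mid S)\ge v(i\mid T)$ for $S\subseteq T$, $i\notin T$, where $v(i\mid S)=v(S\cup\{i\})-v(S)$). Write $v(S^*)$ for the maximum of $v(S)$ over all $S\subseteq N$ with $\sum_{i\in S}c_i\le B$, and $v(i)$ for $v(\{i\})$. The agents arrive one by one in a uniformly random order. The mechanism knows $n$ and is given a prediction $\omega\ge 0$ of $v(S^*)$. The mechanism (parameters $q,a,\beta,k$). (i) With probability $q$ it runs Dynkin's algorithm: the first $\lfloor n/e\rfloor$ agents are only observed; let $i^*$ be the most valuable of them (with respect to $v(i)$). The first later agent $j$ that is at least as valuable as $i^*$ (the first agent, if nobody was observed) is hired and paid $B$. In these comparisons ties between agents of equal value are broken by an arbitrary but fixed order on the agents. (ii) With probability $1-q$ it draws $\xi$ from the binomial distribution with parameters $n$ and $1/k$, lets $N_1$ be the set of the first $\xi$ agents, and computes a set $T_1\subseteq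 N_1$ with $\sum_{i\in T_1}c_i\le B$ whose value $v(T_1)$ is at least $1-\frac1e$ times the maximum of $v(S)$ over $S\subseteq N_1$ with $\sum_{i\in S}c_i\le B$. It sets $t=a\,\omega+\beta\,v(T_1)$, $S=\emptyset$, $B'=B$. Whenever an agent $i\in N\setminus N_1$ arrives, she is offered the price $\bar p_i=\frac Bt\,v(i\mid S)$; if $c_i\le\bar p_i$ and $\bar p_i\le B'$, then $i$ is added to $S$, is paid $\bar p_i$, and $B'$ is reduced by $\bar p_i$. The final set $S$ is hired. Let $A$ be the set of hired agents; the expectation below is over the random order, the choice between (i) and (ii), and $\xi$. Statement. Let $q=0.68$, $a=0.06$, $\beta=0.27$, $k=2.5$. For every monotone submodular instance, every tie-breaking order and every choice of the $(1-\frac1e)$-approximate solutions $T_1=T_1(N_1)$, the mechanism is - $95$-consistent: if $\omega=v(S^*)$, then $95\cdot\mathbb{E}[v(A)]\ge v(S^*)$; - $280$-robust: for every $\omega\in(0,v(S^*)]$, $280\cdot\mathbb{E}[v(A)]\ge v(S^*)$. -/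

import Mathlib

noncomputable section

/-- An instance of the procurement problem with agents `Fin n`: a normalised non-negative valuation
of the sets of agents, a positive budget, and a cost in `(0, budget]` for every agent. -/
structure ProcurementInstance (n : ℕ) where
  value : Finset (Fin n) → ℝ
  cost : Fin n → ℝ
  budget : ℝ
  value_empty : value ∅ = 0
  value_nonneg : ∀ S, 0 ≤ value S
  budget_pos : 0 < budget
  cost_pos : ∀ i, 0 < cost i
  cost_le_budget : ∀ i, cost i ≤ budget

/-- The marginal value `v(i | S)`. -/
def marginalValue {n : ℕ} (v : Finset (Fin n) → ℝ) (i : Fin n) (S : Finset (Fin n)) : ℝ :=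
  v (insert i S) - v S

def IsSubmodular {n : ℕ} (v : Finset (Fin n) → ℝ) : Prop :=
  ∀ S T : Finset (Fin n), S ⊆ T → ∀ i, i ∉ T → marginalValue v i T ≤ marginalValue v i S

/-- What a mechanism returns: the hired agents and the payments. -/
structure Outcome (n : ℕ) where
  winners : Finset (Fin n)
  payment : Fin n → ℝ

/-- The state of the posted-price phase: the current set `S`, the payments, and the remaining
budget `B'`. -/
structure PricingState (n : ℕ) extends Outcome n where
  remaining : ℝ

/-- The parameters that the mechanism uses. -/
structure MechanismParameters where
  /-- the probability of running Dynkin's algorithm -/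
  q : ℝ
  /-- the weight of the prediction in the posted prices -/
  a : ℝ
  /-- the weight of the sample in the posted prices -/
  β : ℝ
  /-- the sample size has the binomial distribution with success probability `1 / k` -/
  k : ℝ

namespace ProcurementInstance

variable {n : ℕ} (I : ProcurementInstance n)

def IsFeasible (S : Finset (Fin n)) : Prop := ∑ i ∈ S, I.cost i ≤ I.budget

theorem isFeasible_empty : I.IsFeasible ∅ := by
  simpa [IsFeasible] using I.budget_pos.le

open Classical in
/-- The largest value of a feasible subset of `M`. -/
def optOn (M : Finset (Fin n)) : ℝ :=
  (M.powerset.filter I.IsFeasible).sup'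
    ⟨∅, Finset.mem_filter.mpr ⟨Finset.empty_mem_powerset M, I.isFeasible_empty⟩⟩ I.value

/-- The optimal offline value `v(S*)`. -/
def opt : ℝ := I.optOn Finset.univ

/-- `solve` returns, for every set `M` of agents, a feasible subset of `M` whose value is at least
`1 - 1/e` times the optimum on `M`. -/
def IsApproxSolver (solve : Finset (Fin n) → Finset (Fin n)) : Prop :=
  ∀ M, solve M ⊆ M ∧ I.IsFeasible (solve M) ∧
    (1 - 1 / Real.exp 1) * I.optOn M ≤ I.value (solve M)

/-- Agent `j` is more valuable than agent `i`: single-agent values are compared, and ties are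
broken by the fixed order of the agents in which agent `i` has rank `rank i`. For two different
agents of different values this is `v(j) ≥ v(i)`. -/
def MoreValuable (rank : Equiv.Perm (Fin n)) (i j : Fin n) : Prop :=
  I.value {i} < I.value {j} ∨ (I.value {i} = I.value {j} ∧ rank i < rank j)

/-- The agents in their order of arrival: `π 0, π 1, …, π (n - 1)`. -/
def arrivals (π : Equiv.Perm (Fin n)) : List (Fin n) := List.ofFn π

open Classical in
/-- Dynkin's algorithm: the first `⌊n/e⌋` agents are only sampled; the first later agent who is more
valuable than the most valuable sampled agent (that is, than every sampled agent) is hired and is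
paid the whole budget. With an empty sample the first agent is hired. -/
def dynkin (rank : Equiv.Perm (Fin n)) (π : Equiv.Perm (Fin n)) : Outcome n :=
  let r : ℕ := ⌊(n : ℝ) / Real.exp 1⌋₊
  let sample := (arrivals π).take r
  match ((arrivals π).drop r).find? (fun j => decide (∀ i ∈ sample, I.MoreValuable rank i j)) with
  | none => ⟨∅, 0⟩
  | some j => ⟨{j}, Pi.single j I.budget⟩

/-- The arrival of agent `i` in the posted-price phase: she is offered `(B / t) · v(i | S)`, and is
hired at this price if it covers her cost and does not exceed the remaining budget. -/
def pricingStep (t : ℝ) (s : PricingState n) (i : Fin n) : PricingState n :=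
  let price := I.budget / t * marginalValue I.value i s.winners
  if I.cost i ≤ price ∧ 0 ≤ s.remaining - price then
    { winners := insert i s.winners
      payment := Function.update s.payment i price
      remaining := s.remaining - price }
  else s

/-- The sampling branch for the arrival order `π` and the sample size `ξ`: the set `N₁` of the first
`ξ` agents is only used to fix `t = a ω + β v(T₁)`, where `T₁` is the approximate solution on `N₁`;
the later agents are then treated one by one in their order of arrival. -/
def samplingBranch (P : MechanismParameters) (solve : Finset (Fin n) → Finset (Fin n))
    (ω : ℝ) (π : Equiv.Perm (Fin n)) (ξ : ℕ) : Outcome n :=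
  let N₁ : Finset (Fin n) := ((arrivals π).take ξ).toFinset
  let t : ℝ := P.a * ω + P.β * I.value (solve N₁)
  (((arrivals π).drop ξ).foldl (I.pricingStep t) ⟨⟨∅, 0⟩, I.budget⟩).toOutcome

/-- The expected value `𝔼[v(A)]` of the set hired by the mechanism with prediction `ω`. The
expectation is over the uniformly random arrival order `π`, over the choice of the branch (Dynkin's
algorithm with probability `q`), and over the sample size `ξ`, which is binomial with parameters
`n` and `1 / k`; the three are independent. -/
def expectedValue (P : MechanismParameters) (rank : Equiv.Perm (Fin n))
    (solve : Finset (Fin n) → Finset (Fin n)) (ω : ℝ) : ℝ :=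
  (∑ π : Equiv.Perm (Fin n),
    (P.q * I.value (I.dynkin rank π).winners +
      (1 - P.q) * ∑ ξ ∈ Finset.range (n + 1),
        ((n.choose ξ : ℝ) * (1 / P.k) ^ ξ * (1 - 1 / P.k) ^ (n - ξ)) *
          I.value (I.samplingBranch P solve ω π ξ).winners)) / (n.factorial : ℝ)

end ProcurementInstance

namespace MechanismParameters

/-- `α`-consistency for monotone submodular valuations: on every instance, with a perfect prediction,
the mechanism with parameters `P` gets in expectation at least a `1 / α` fraction of the optimum,
for every tie-breaking order and every `(1 - 1/e)`-approximate offline solver. -/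
def IsConsistent (P : MechanismParameters) (α : ℝ) : Prop :=
  ∀ (n : ℕ) (I : ProcurementInstance n), Monotone I.value → IsSubmodular I.value →
    ∀ (rank : Equiv.Perm (Fin n)) (solve : Finset (Fin n) → Finset (Fin n)),
      I.IsApproxSolver solve →
        ∀ ω : ℝ, ω = I.opt → I.opt ≤ α * I.expectedValue P rank solve ω

/-- `α`-robustness for monotone submodular valuations: the same with an arbitrary prediction
`ω` in `(0, v(S*)]`. -/
def IsRobust (P : MechanismParameters) (α : ℝ) : Prop :=
  ∀ (n : ℕ) (I : ProcurementInstance n), Monotone I.value → IsSubmodular I.value →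
    ∀ (rank : Equiv.Perm (Fin n)) (solve : Finset (Fin n) → Finset (Fin n)),
      I.IsApproxSolver solve →
        ∀ ω : ℝ, 0 < ω → ω ≤ I.opt → I.opt ≤ α * I.expectedValue P rank solve ω

end MechanismParameters

end

open Finset

/-! Let `V` be the optimum and `x` the largest value of a single agent. Dynkin's branch covers
instances with large `x`: it earns at least `x / 5` on average (`le_sum_value_dynkin`). The sampling
branch covers small `x`: it earns at least `0.06 ω + 0.068256 V - 1.5808 x`
(`le_sum_value_samplingBranch`). A convex combination of the two bounds eliminates `x`.

For the sampling branch, posted prices with threshold `t` either spend the budget up to one agent,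
giving `t - x`, or leave only overpriced agents, giving `v(R) - t` for each feasible set `R` of
later agents (`value_le_of_posted_prices`). Take `R = S* \ N₁` and minorise `v` on subsets of `S*`
by an additive `w` with `w(S*) = V` (`exists_additive_le`). With `W = w(N₁)`, the later part of `S*`
is worth at least `V - W`, and `v(T₁) ≥ 0.632 W`. A prefix of binomial length in a random order
contains each agent independently with probability `0.4`, so `W` has mean `0.4 V` and variance at
most `0.24 x V`. No tail bound is needed: `sample_tradeoff` bounds the gain below by a quadratic in
`W`, so two moments suffice. -/

/-! ### Moments of a random prefix of binomial length -/

theorem Equiv.Perm.sum_apply_pair_eq {n : ℕ} (F : Fin n → Fin n → ℝ) {k l k' l' : Fin n}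
    (h : k ≠ l) (h' : k' ≠ l') :
    ∑ π : Equiv.Perm (Fin n), F (π k) (π l) = ∑ π : Equiv.Perm (Fin n), F (π k') (π l') := by
  -- The first swap sends `k` to `k'`; the second sends the image of `l` to `l'` and fixes `k'`.
  let σ : Equiv.Perm (Fin n) := Equiv.swap (Equiv.swap k k' l) l' * Equiv.swap k k'
  have hl : σ l = l' := by simp [σ]
  have hk : σ k = k' := by
    have : Equiv.swap k k' l ≠ k' := fun e => h <| by
      rw [Equiv.swap_apply_eq_iff] at e; simpa using e.symm
    simp [σ, Equiv.swap_apply_of_ne_of_ne this.symm h']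
  rw [← Equiv.sum_comp (Equiv.mulRight σ)]
  simp [hk, hl]

/-- A pair of different positions holds a uniformly random pair of different elements. -/
theorem Equiv.Perm.sum_apply_pair {n : ℕ} (F : Fin n → Fin n → ℝ) {k l : Fin n} (h : k ≠ l) :
    ((n : ℝ) * (n - 1)) * ∑ π : Equiv.Perm (Fin n), F (π k) (π l) =
      n.factorial * ∑ p ∈ (univ : Finset (Fin n)).offDiag, F p.1 p.2 := by
  have h1 : ∑ p ∈ (univ : Finset (Fin n)).offDiag,
      ∑ π : Equiv.Perm (Fin n), F (π p.1) (π p.2) =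
      ((n : ℝ) * (n - 1)) * ∑ π : Equiv.Perm (Fin n), F (π k) (π l) := by
    rw [Finset.sum_congr rfl (fun p hp => Equiv.Perm.sum_apply_pair_eq F
      (Finset.mem_offDiag.1 hp).2.2 h), Finset.sum_const, offDiag_card, nsmul_eq_mul]
    rw [Finset.card_univ, Fintype.card_fin, Nat.cast_sub (Nat.le_mul_self n)]
    push_cast; ring
  have h2 : ∀ π : Equiv.Perm (Fin n), ∑ p ∈ (univ : Finset (Fin n)).offDiag, F (π p.1) (π p.2) =
      ∑ p ∈ (univ : Finset (Fin n)).offDiag, F p.1 p.2 := fun π =>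
    Finset.sum_equiv (π.prodCongr π) (by simp) (by simp)
  rw [← h1, Finset.sum_comm, Finset.sum_congr rfl (fun π _ => h2 π), Finset.sum_const,
    Finset.card_univ, Fintype.card_perm, Fintype.card_fin, nsmul_eq_mul]

/-- A position holds a uniformly random element. -/
theorem Equiv.Perm.sum_apply {n : ℕ} (f : Fin n → ℝ) (k : Fin n) :
    (n : ℝ) * ∑ π : Equiv.Perm (Fin n), f (π k) = n.factorial * ∑ i, f i := by
  have h0 : ∀ l, ∑ π : Equiv.Perm (Fin n), f (π l) = ∑ π : Equiv.Perm (Fin n), f (π k) := by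
    intro l
    rw [← Equiv.sum_comp (Equiv.mulRight (Equiv.swap k l))]
    simp
  have h1 : ∑ l, ∑ π : Equiv.Perm (Fin n), f (π l) =
      (n : ℝ) * ∑ π : Equiv.Perm (Fin n), f (π k) := by
    rw [Finset.sum_congr rfl (fun l _ => h0 l)]; simp
  rw [← h1, Finset.sum_comm, Finset.sum_congr rfl (fun π _ => Equiv.sum_comp π f), Finset.sum_const,
    Finset.card_univ, Fintype.card_perm, Fintype.card_fin, nsmul_eq_mul]

theorem sum_binomial (n : ℕ) (p : ℝ) :
    ∑ ξ ∈ range (n + 1), (n.choose ξ : ℝ) * p ^ ξ * (1 - p) ^ (n - ξ) = 1 := by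
  simpa [bernsteinPolynomial, Polynomial.eval_finsetSum] using
    congrArg (Polynomial.eval p) (bernsteinPolynomial.sum ℝ n)

theorem sum_binomial_mul (n : ℕ) (p : ℝ) :
    ∑ ξ ∈ range (n + 1), (n.choose ξ : ℝ) * p ^ ξ * (1 - p) ^ (n - ξ) * ξ = n * p := by
  simpa [bernsteinPolynomial, Polynomial.eval_finsetSum, mul_comm] using
    congrArg (Polynomial.eval p) (bernsteinPolynomial.sum_smul ℝ n)

theorem sum_binomial_mul_pred (n : ℕ) (p : ℝ) :
    ∑ ξ ∈ range (n + 1), (n.choose ξ : ℝ) * p ^ ξ * (1 - p) ^ (n - ξ) * (ξ * (ξ - 1)) =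
      n * (n - 1) * p ^ 2 := by
  -- The Bernstein identity uses truncated subtraction, harmless at `m = 0` because of the factor
  -- `m`.
  have hc : ∀ m : ℕ, ((m * (m - 1) : ℕ) : ℝ) = m * (m - 1) := by
    rintro (_ | m) <;> simp
  have := congrArg (Polynomial.eval p) (bernsteinPolynomial.sum_mul_smul ℝ n)
  simp only [bernsteinPolynomial, Polynomial.eval_finsetSum, nsmul_eq_mul, Polynomial.eval_mul,
    Polynomial.eval_pow, Polynomial.eval_sub, Polynomial.eval_one, Polynomial.eval_X,
    Polynomial.eval_natCast, hc] at this
  rw [← this]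
  exact Finset.sum_congr rfl fun ξ _ => by ring

/-- The sum of `w` over the first `ξ` places of a random order, the number `ξ` of places being
binomial: first moment. -/
theorem sum_perm_sum_binomial_prefix {n : ℕ} (p : ℝ) (w : Fin n → ℝ) :
    ∑ π : Equiv.Perm (Fin n), ∑ ξ ∈ range (n + 1),
      ((n.choose ξ : ℝ) * p ^ ξ * (1 - p) ^ (n - ξ)) * ∑ k ∈ univ.filter (fun k : Fin n => (k : ℕ) < ξ), w (π k) =
      n.factorial * (p * ∑ i, w i) := by
  rw [Finset.sum_comm]
  rcases Nat.eq_zero_or_pos n with rfl | hn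
  · simp
  have hn' : (n : ℝ) ≠ 0 := by positivity
  have key : ∀ ξ ∈ range (n + 1), ∑ π : Equiv.Perm (Fin n),
      ((n.choose ξ : ℝ) * p ^ ξ * (1 - p) ^ (n - ξ)) * ∑ k ∈ univ.filter (fun k : Fin n => (k : ℕ) < ξ), w (π k) =
      ((n.choose ξ : ℝ) * p ^ ξ * (1 - p) ^ (n - ξ)) * ξ *
        (n.factorial * (∑ i, w i) / n) := by
    intro ξ hξ
    rw [← Finset.mul_sum, Finset.sum_comm, mul_assoc _ (ξ : ℝ)]
    refine congrArg _ ?_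
    have : ∀ k : Fin n, ∑ π : Equiv.Perm (Fin n), w (π k) = n.factorial * (∑ i, w i) / n := by
      intro k
      rw [← Equiv.Perm.sum_apply w k]; field_simp
    rw [Finset.sum_congr rfl (fun k _ => this k), Finset.sum_const, nsmul_eq_mul,
      Fin.card_filter_val_lt]
    simp at hξ
    rw [min_eq_right (by omega)]
  rw [Finset.sum_congr rfl key, ← Finset.sum_mul, sum_binomial_mul]
  field_simp

/-- The second moment of the same random sum. -/
theorem sum_perm_sum_binomial_prefix_sq {n : ℕ} (p : ℝ) (w : Fin n → ℝ) :
    ∑ π : Equiv.Perm (Fin n), ∑ ξ ∈ range (n + 1),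
      ((n.choose ξ : ℝ) * p ^ ξ * (1 - p) ^ (n - ξ)) *
        (∑ k ∈ univ.filter (fun k : Fin n => (k : ℕ) < ξ), w (π k)) ^ 2 =
      n.factorial * (p ^ 2 * (∑ i, w i) ^ 2 + p * (1 - p) * ∑ i, w i ^ 2) := by
  have hsplit : ∀ (s : Finset (Fin n)) (f : Fin n → ℝ),
      (∑ i ∈ s, f i) ^ 2 = ∑ i ∈ s, f i ^ 2 + ∑ q ∈ s.offDiag, f q.1 * f q.2 := by
    intro s f
    rw [sq, Finset.sum_mul_sum, ← Finset.sum_product', ← Finset.diag_union_offDiag,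
      Finset.sum_union (Finset.disjoint_diag_offDiag s), Finset.sum_diag]
    simp [sq]
  -- `P` is kept abstract because `n * (n - 1)` vanishes for `n ≤ 1`, so it cannot be obtained by
  -- division.
  have hpair : ∃ P : ℝ, (∀ k l : Fin n, k ≠ l →
      ∑ π : Equiv.Perm (Fin n), w (π k) * w (π l) = P) ∧ (n : ℝ) * (n - 1) * P =
        n.factorial * ∑ q ∈ (univ : Finset (Fin n)).offDiag, w q.1 * w q.2 := by
    by_cases h : ∃ k l : Fin n, k ≠ l
    · obtain ⟨k, l, h⟩ := h
      exact ⟨_, fun k' l' h' => Equiv.Perm.sum_apply_pair_eq (fun i j => w i * w j) h' h,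
        Equiv.Perm.sum_apply_pair (fun i j => w i * w j) h⟩
    · push Not at h
      refine ⟨0, fun k l hkl => absurd (h k l) hkl, ?_⟩
      rw [Finset.sum_eq_zero]
      · simp
      · intro q hq
        exact absurd (h q.1 q.2) (Finset.mem_offDiag.1 hq).2.2
  obtain ⟨P, hP, hP'⟩ := hpair
  have hoff : ∑ π : Equiv.Perm (Fin n), ∑ ξ ∈ range (n + 1),
      ((n.choose ξ : ℝ) * p ^ ξ * (1 - p) ^ (n - ξ)) *
        ∑ q ∈ (univ.filter fun k : Fin n => (k : ℕ) < ξ).offDiag, w (π q.1) * w (π q.2) =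
      n.factorial * (p ^ 2 * ∑ q ∈ (univ : Finset (Fin n)).offDiag, w q.1 * w q.2) := by
    rw [Finset.sum_comm]
    have key : ∀ ξ ∈ range (n + 1), ∑ π : Equiv.Perm (Fin n),
        ((n.choose ξ : ℝ) * p ^ ξ * (1 - p) ^ (n - ξ)) *
          ∑ q ∈ (univ.filter fun k : Fin n => (k : ℕ) < ξ).offDiag, w (π q.1) * w (π q.2) =
        ((n.choose ξ : ℝ) * p ^ ξ * (1 - p) ^ (n - ξ)) * (ξ * (ξ - 1)) * P := by
      intro ξ hξ
      rw [← Finset.mul_sum, Finset.sum_comm, mul_assoc _ ((ξ : ℝ) * _)]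
      refine congrArg _ ?_
      rw [Finset.sum_congr rfl (fun q hq => hP q.1 q.2 (Finset.mem_offDiag.1 hq).2.2),
        Finset.sum_const, nsmul_eq_mul, offDiag_card, Fin.card_filter_val_lt]
      simp at hξ
      rw [min_eq_right (by omega), Nat.cast_sub (Nat.le_mul_self ξ)]
      push_cast; ring
    rw [Finset.sum_congr rfl key, ← Finset.sum_mul, sum_binomial_mul_pred]
    linear_combination p ^ 2 * hP'
  have hdiag := sum_perm_sum_binomial_prefix p (fun i => w i ^ 2)
  simp only [hsplit, mul_add, Finset.sum_add_distrib] at hdiag hoff ⊢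
  rw [hdiag, hoff]
  ring

/-! ### Submodular functions and additive minorants -/

section Submodular

variable {n : ℕ} {v : Finset (Fin n) → ℝ}

theorem IsSubmodular.value_union_le (hv : IsSubmodular v) (S R : Finset (Fin n)) :
    v (S ∪ R) ≤ v S + ∑ i ∈ R \ S, marginalValue v i S := by
  induction R using Finset.induction_on with
  | empty => simp
  | insert a R ha ih =>
    by_cases haS : a ∈ S
    · rwa [Finset.union_insert, Finset.insert_eq_self.2 (Finset.mem_union_left _ haS),
        Finset.insert_sdiff_of_mem _ haS]
    · have h := hv S (S ∪ R) Finset.subset_union_left a (by simp [haS, ha])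
      rw [Finset.union_insert, Finset.insert_sdiff_of_notMem _ haS,
        Finset.sum_insert (by simp [ha])]
      unfold marginalValue at *
      linarith

theorem IsSubmodular.marginalValue_le (hv : IsSubmodular v) (h0 : v ∅ = 0)
    (hnn : ∀ S, 0 ≤ v S) (i : Fin n) (S : Finset (Fin n)) : marginalValue v i S ≤ v {i} := by
  by_cases hi : i ∈ S
  · simpa [marginalValue, hi] using hnn {i}
  · simpa [marginalValue, h0] using hv ∅ S (Finset.empty_subset S) i hi

/-- A point of the base polytope of `v` restricted to `S`: the marginal values along an order. -/
theorem IsSubmodular.exists_additive_le (hv : IsSubmodular v) (hm : Monotone v) (h0 : v ∅ = 0)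
    (hnn : ∀ S, 0 ≤ v S) (S : Finset (Fin n)) :
    ∃ w : Fin n → ℝ, (∀ i, 0 ≤ w i) ∧ (∀ i, i ∉ S → w i = 0) ∧ (∀ i, w i ≤ v {i}) ∧
      ∑ i ∈ S, w i = v S ∧ ∀ R, R ⊆ S → ∑ i ∈ R, w i ≤ v R := by
  induction S using Finset.induction_on with
  | empty =>
    refine ⟨0, by simp, by simp, by simpa using fun i => hnn {i}, by simp [h0], ?_⟩
    intro R hR
    simpa using hnn R
  | insert a S ha ih =>
    obtain ⟨w, hw0, hwS, hwv, hsum, hle⟩ := ih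
    have hsame : ∀ R : Finset (Fin n), a ∉ R →
        ∑ i ∈ R, Function.update w a (marginalValue v a S) i = ∑ i ∈ R, w i := fun R haR =>
      Finset.sum_congr rfl fun i hi =>
        Function.update_of_ne (ne_of_mem_of_not_mem hi haR) _ _
    refine ⟨Function.update w a (marginalValue v a S), ?_, ?_, ?_, ?_, ?_⟩
    · intro i
      rcases eq_or_ne i a with rfl | hi
      · simpa [marginalValue] using hm (Finset.subset_insert i S)
      · simpa [hi] using hw0 i
    · intro i hi
      simp only [Finset.mem_insert, not_or] at hi
      simpa [hi.1] using hwS i hi.2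
    · intro i
      rcases eq_or_ne i a with rfl | hi
      · simpa using hv.marginalValue_le h0 hnn i S
      · simpa [hi] using hwv i
    · rw [Finset.sum_insert ha, hsame S ha, hsum]
      simp [marginalValue]
    · intro R hR
      by_cases haR : a ∈ R
      · have hsub : R.erase a ⊆ S := by
          intro i hi
          have := hR (Finset.mem_of_mem_erase hi)
          simpa [Finset.ne_of_mem_erase hi] using this
        have h1 := hle _ hsub
        have h2 := hv _ _ hsub a ha
        rw [← Finset.insert_erase haR, Finset.sum_insert (Finset.notMem_erase a R),
          hsame _ (Finset.notMem_erase a R), Function.update_self]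
        have h3 : marginalValue v a (R.erase a) = v (insert a (R.erase a)) - v (R.erase a) := rfl
        linarith
      · rw [hsame R haR]
        refine hle R fun i hi => ?_
        have := hR hi
        rw [Finset.mem_insert] at this
        exact this.resolve_left fun e => haR (e ▸ hi)

end Submodular

/-! ### The posted-price phase -/

namespace ProcurementInstance

variable {n : ℕ} (I : ProcurementInstance n)

theorem isFeasible_mono {S T : Finset (Fin n)} (h : S ⊆ T) (hT : I.IsFeasible T) :
    I.IsFeasible S :=
  (Finset.sum_le_sum_of_subset_of_nonneg h fun i _ _ => (I.cost_pos i).le).trans hT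

theorem value_le_optOn {M S : Finset (Fin n)} (h : S ⊆ M) (hS : I.IsFeasible S) :
    I.value S ≤ I.optOn M := by
  classical
  unfold optOn
  exact Finset.le_sup' I.value (by simp [h, hS])

theorem exists_isFeasible_value_eq_opt : ∃ S, I.IsFeasible S ∧ I.value S = I.opt := by
  classical
  obtain ⟨S, hS, h⟩ := Finset.exists_mem_eq_sup' (s := (Finset.univ.powerset.filter I.IsFeasible))
    ⟨∅, Finset.mem_filter.mpr ⟨Finset.empty_mem_powerset _, I.isFeasible_empty⟩⟩ I.value
  refine ⟨S, (Finset.mem_filter.1 hS).2, ?_⟩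
  rw [← h]; unfold opt optOn; congr!

theorem opt_nonneg : 0 ≤ I.opt := by
  obtain ⟨S, -, h⟩ := I.exists_isFeasible_value_eq_opt
  exact h ▸ I.value_nonneg S

variable {I}

theorem subset_foldl_pricingStep (t : ℝ) (l : List (Fin n)) (s : PricingState n) :
    s.winners ⊆ (l.foldl (I.pricingStep t) s).winners := by
  induction l generalizing s with
  | nil => simp
  | cons i l ih =>
    refine Finset.Subset.trans ?_ (ih _)
    unfold pricingStep
    dsimp only
    split_ifs
    · exact Finset.subset_insert _ _
    · exact Finset.Subset.refl _

/-- Either the posted prices exhaust the budget up to one agent, or every agent that is not hired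
is too expensive with respect to the final set. -/
theorem foldl_pricingStep_dichotomy (hm : Monotone I.value) (hs : IsSubmodular I.value)
    {t x : ℝ} (ht : 0 < t) (hx : ∀ i, I.value {i} ≤ x) (l : List (Fin n)) (s : PricingState n)
    (hinv : s.remaining = I.budget - I.budget / t * I.value s.winners) :
    t - x ≤ I.value (l.foldl (I.pricingStep t) s).winners ∨
      ∀ i ∈ l, i ∉ (l.foldl (I.pricingStep t) s).winners →
        marginalValue I.value i (l.foldl (I.pricingStep t) s).winners ≤ t / I.budget * I.cost i := by
  have hB := I.budget_pos
  induction l generalizing s with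
  | nil => simp
  | cons a l ih =>
    rw [List.foldl_cons]
    by_cases hc : I.cost a ≤ I.budget / t * marginalValue I.value a s.winners
    · by_cases hr : 0 ≤ s.remaining - I.budget / t * marginalValue I.value a s.winners
      · have hstep : I.pricingStep t s a =
            { winners := insert a s.winners
              payment := Function.update s.payment a
                (I.budget / t * marginalValue I.value a s.winners)
              remaining := s.remaining - I.budget / t * marginalValue I.value a s.winners } := by
          unfold pricingStep
          exact if_pos ⟨hc, hr⟩
        have hin : a ∈ (l.foldl (I.pricingStep t) (I.pricingStep t s a)).winners :=
          subset_foldl_pricingStep t l _ (by simp [hstep])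
        refine (ih (I.pricingStep t s a) ?_).imp id fun h i hi hni => ?_
        · rw [hstep]
          simp only [hinv, marginalValue]
          ring
        · rcases List.mem_cons.1 hi with rfl | hi
          · exact absurd hin hni
          · exact h i hi hni
      -- The price fits the cost but not the remaining budget. As payments telescope to `(B / t)
      -- v(S)`, this means `v(S) + v(a | S) > t`.
      · left
        have hle := hm (subset_foldl_pricingStep (I := I) t (a :: l) s)
        rw [List.foldl_cons] at hle
        have hma := hs.marginalValue_le I.value_empty I.value_nonneg a s.winners
        have hxa := hx a
        push Not at hr
        have h1 : I.budget / t * t < I.budget / t *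
            (I.value s.winners + marginalValue I.value a s.winners) := by
          rw [div_mul_cancel₀ _ ht.ne']
          linarith
        have h2 := lt_of_mul_lt_mul_left h1 (by positivity)
        linarith
    · have hstep : I.pricingStep t s a = s := by
        unfold pricingStep
        exact if_neg fun h => hc h.1
      rw [hstep]
      refine (ih s hinv).imp id fun h i hi hni => ?_
      rcases List.mem_cons.1 hi with rfl | hi
      -- The price was too low on arrival; submodularity carries this to the larger final set.
      · have h1 := hs _ _ (subset_foldl_pricingStep (I := I) t l s) i hni
        push Not at hc
        rw [div_mul_eq_mul_div, le_div_iff₀ hB]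
        rw [div_mul_eq_mul_div, div_lt_iff₀ ht] at hc
        nlinarith
      · exact h i hi hni

/-- If the budget is not exhausted, each agent of `R` that is not hired adds at most `(t / B) c_i`
to the final set, and feasibility bounds the total by `t`. -/
theorem value_le_of_posted_prices (hm : Monotone I.value) (hs : IsSubmodular I.value)
    {t x : ℝ} (ht : 0 < t) (hx : ∀ i, I.value {i} ≤ x) (l : List (Fin n))
    {R : Finset (Fin n)} (hR : I.IsFeasible R) (hRl : ∀ i ∈ R, i ∈ l) :
    min (t - x) (I.value R - t) ≤
      I.value (l.foldl (I.pricingStep t) ⟨⟨∅, 0⟩, I.budget⟩).winners := by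
  have hB := I.budget_pos
  rcases foldl_pricingStep_dichotomy hm hs ht hx l ⟨⟨∅, 0⟩, I.budget⟩
    (by simp [I.value_empty]) with h | h
  · exact (min_le_left _ _).trans h
  · refine (min_le_right _ _).trans ?_
    set S := (l.foldl (I.pricingStep t) ⟨⟨∅, 0⟩, I.budget⟩).winners
    have h1 : I.value R ≤ I.value (S ∪ R) := hm Finset.subset_union_right
    have h2 := hs.value_union_le S R
    have h3 : ∑ i ∈ R \ S, marginalValue I.value i S ≤ ∑ i ∈ R \ S, t / I.budget * I.cost i :=
      Finset.sum_le_sum fun i hi =>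
        h i (hRl i (Finset.mem_sdiff.1 hi).1) (Finset.mem_sdiff.1 hi).2
    have h4 : ∑ i ∈ R \ S, t / I.budget * I.cost i ≤ t := by
      rw [← Finset.mul_sum, div_mul_eq_mul_div, div_le_iff₀ hB]
      exact mul_le_mul_of_nonneg_left (I.isFeasible_mono Finset.sdiff_subset hR) ht.le
    linarith

end ProcurementInstance

/-! ### Dynkin's algorithm -/

/-- With `r = ⌊n/e⌋`, the second best agent is sampled and the best is not with probability `r(n -
r) / (n(n - 1))`. Its limit `(1/e)(1 - 1/e) ≈ 0.2325` leaves slack for large `n`; equality holds at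
`n = 5`. -/
theorem mul_pred_le_of_floor_div_exp_one {n : ℕ} (hn : 3 ≤ n) :
    (n : ℝ) * (n - 1) ≤
      5 * ((⌊(n : ℝ) / Real.exp 1⌋₊ : ℝ) * (n - (⌊(n : ℝ) / Real.exp 1⌋₊ : ℝ))) := by
  have he1 := Real.exp_one_gt_d9
  have he2 := Real.exp_one_lt_d9
  have hn0 : (0 : ℝ) ≤ n := n.cast_nonneg
  have hpos := Real.exp_pos 1
  have h1 : (⌊(n : ℝ) / Real.exp 1⌋₊ : ℝ) ≤ n / Real.exp 1 := Nat.floor_le (by positivity)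
  have h2 := Nat.lt_floor_add_one ((n : ℝ) / Real.exp 1)
  generalize ⌊(n : ℝ) / Real.exp 1⌋₊ = r at *
  rw [le_div_iff₀ hpos] at h1
  rw [div_lt_iff₀ hpos] at h2
  have hr0 : (0 : ℝ) ≤ r := r.cast_nonneg
  -- Rational bounds on `e` reduce the range `n < 20` to integer arithmetic.
  have h3 : (27182 : ℝ) * r ≤ 10000 * n := by nlinarith
  have h4 : (10000 : ℝ) * n < 27183 * (r + 1) := by nlinarith
  rcases le_or_gt 20 n with h20 | h20
  · have h20' : (20 : ℝ) ≤ n := by exact_mod_cast h20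
    nlinarith [mul_nonneg (sub_nonneg.2 h3) (sub_nonneg.2 h4.le)]
  · have h3' : 27182 * r ≤ 10000 * n := by exact_mod_cast h3
    have h4' : 10000 * n < 27183 * (r + 1) := by exact_mod_cast h4
    have hr : r ≤ 6 := by omega
    clear h1 h2 h3 h4 hn0 hr0
    interval_cases r <;> (try omega) <;> interval_cases n <;> (try omega) <;> norm_num

namespace ProcurementInstance

variable {n : ℕ} {I : ProcurementInstance n}

theorem mem_take_arrivals {π : Equiv.Perm (Fin n)} {r : ℕ} {i : Fin n} :
    i ∈ (arrivals π).take r ↔ (π.symm i : ℕ) < r := by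
  rw [arrivals, List.mem_take_iff_getElem]
  constructor
  · rintro ⟨k, hk, rfl⟩
    simp only [List.getElem_ofFn, Equiv.symm_apply_apply]
    omega
  · intro h
    exact ⟨π.symm i, by simp [h], by simp⟩

theorem mem_drop_arrivals {π : Equiv.Perm (Fin n)} {r : ℕ} {i : Fin n} :
    i ∈ (arrivals π).drop r ↔ r ≤ (π.symm i : ℕ) := by
  rw [arrivals, List.mem_drop_iff_getElem]
  constructor
  · rintro ⟨k, hk, rfl⟩
    simp
  · intro h
    have := (π.symm i).isLt
    refine ⟨π.symm i - r, by simp; omega, ?_⟩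
    have : r + ((π.symm i : ℕ) - r) = (π.symm i : ℕ) := by omega
    simp [this]

theorem sum_toFinset_take_arrivals (w : Fin n → ℝ) (π : Equiv.Perm (Fin n)) (ξ : ℕ) :
    ∑ i ∈ ((arrivals π).take ξ).toFinset, w i =
      ∑ k ∈ univ.filter (fun k : Fin n => (k : ℕ) < ξ), w (π k) := by
  refine (Finset.sum_equiv π ?_ fun _ _ => rfl).symm
  intro k
  simp [mem_take_arrivals]

theorem MoreValuable.asymm {rank : Equiv.Perm (Fin n)} {i j : Fin n}
    (h : I.MoreValuable rank i j) : ¬ I.MoreValuable rank j i := by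
  rintro (h' | h') <;> rcases h with h | h
  · exact lt_asymm h h'
  · exact h'.ne h.1.symm
  · exact h.ne h'.1.symm
  · exact lt_asymm h.2 h'.2

theorem exists_forall_moreValuable (I : ProcurementInstance n) (rank : Equiv.Perm (Fin n))
    {M : Finset (Fin n)} (hM : M.Nonempty) :
    ∃ m ∈ M, ∀ i ∈ M, i ≠ m → I.MoreValuable rank i m := by
  -- Maximise lexicographically; injectivity of `rank` makes the maximum strict.
  obtain ⟨m, hm, h⟩ := M.exists_max_image (fun i => toLex (I.value {i}, rank i)) hM
  refine ⟨m, hm, fun i hi hne => ?_⟩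
  have h1 := h i hi
  rw [Prod.Lex.toLex_le_toLex] at h1
  refine h1.imp id fun h2 => ⟨h2.1, lt_of_le_of_ne h2.2 fun e => hne (rank.injective e)⟩

/-- Dynkin's algorithm hires the best agent if the second best agent is sampled and the best agent
is not. -/
theorem winners_dynkin_eq {rank π : Equiv.Perm (Fin n)} {m m' : Fin n}
    (hm : ∀ i, i ≠ m → I.MoreValuable rank i m)
    (hm' : ∀ i, i ≠ m → i ≠ m' → I.MoreValuable rank i m')
    (h1 : (π.symm m' : ℕ) < ⌊(n : ℝ) / Real.exp 1⌋₊)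
    (h2 : ⌊(n : ℝ) / Real.exp 1⌋₊ ≤ (π.symm m : ℕ)) :
    (I.dynkin rank π).winners = {m} := by
  unfold dynkin
  dsimp only
  split
  · next h =>
    rw [List.find?_eq_none] at h
    refine absurd (h m (mem_drop_arrivals.2 h2)) ?_
    simp only [decide_eq_true_eq, not_not]
    intro i hi
    refine hm i ?_
    rintro rfl
    have := mem_take_arrivals.1 hi
    omega
  · next j h =>
    have h3 := List.find?_some h
    simp only [decide_eq_true_eq] at h3
    have h4 := h3 m' (mem_take_arrivals.2 h1)
    by_contra hne
    have hjm : j ≠ m := fun e => hne (by rw [e])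
    have hjm' : j ≠ m' := by
      rintro rfl
      exact h4.asymm h4
    exact h4.asymm (hm' j hjm hjm')

theorem winners_dynkin_of_floor_eq_zero {rank π : Equiv.Perm (Fin n)} (hn : 0 < n)
    (h : ⌊(n : ℝ) / Real.exp 1⌋₊ = 0) : (I.dynkin rank π).winners = {π ⟨0, hn⟩} := by
  unfold dynkin
  generalize ⌊(n : ℝ) / Real.exp 1⌋₊ = r at *
  subst h
  obtain ⟨m, rfl⟩ : ∃ m, n = m + 1 := ⟨n - 1, by omega⟩
  simp [arrivals, List.ofFn_succ]

/-- Dynkin's algorithm gets at least a fifth of the value of the best agent. -/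
theorem le_sum_value_dynkin (rank : Equiv.Perm (Fin n)) (i : Fin n) :
    n.factorial * (I.value {i} / 5) ≤
      ∑ π : Equiv.Perm (Fin n), I.value (I.dynkin rank π).winners := by
  have hn : 0 < n := i.pos
  obtain hn3 | hn3 := le_or_gt 3 n
  · set r := ⌊(n : ℝ) / Real.exp 1⌋₊ with hr
    have hn0 : (0 : ℝ) < n := by positivity
    have hrn : r ≤ n := by
      refine Nat.floor_le_of_le (div_le_self hn0.le ?_)
      simp
    obtain ⟨m, -, hm⟩ := I.exists_forall_moreValuable rank (M := univ) ⟨i, mem_univ i⟩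
    have : (univ.erase m).Nonempty := by
      rw [← Finset.card_pos, Finset.card_erase_of_mem (mem_univ m), Finset.card_univ,
        Fintype.card_fin]
      omega
    obtain ⟨m', hmm', hm'⟩ := I.exists_forall_moreValuable rank this
    have him : I.value {i} ≤ I.value {m} := by
      rcases eq_or_ne i m with rfl | hne
      · exact le_rfl
      · rcases hm i (mem_univ i) hne with h | h
        · exact h.le
        · exact h.1.le
    let F : Fin n → Fin n → ℝ := fun k l => if (k : ℕ) < r ∧ r ≤ (l : ℕ) then 1 else 0
    have hpt : ∀ π : Equiv.Perm (Fin n), F (π.symm m') (π.symm m) * I.value {m} ≤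
        I.value (I.dynkin rank π).winners := by
      intro π
      by_cases h : (π.symm m' : ℕ) < r ∧ r ≤ (π.symm m : ℕ)
      · rw [winners_dynkin_eq (fun j hj => hm j (mem_univ j) hj)
          (fun j hj hj' => hm' j (Finset.mem_erase.2 ⟨hj, mem_univ j⟩) hj') h.1 h.2]
        simp [F, h]
      · simp only [F, if_neg h, zero_mul]
        exact I.value_nonneg _
    -- Arrival positions are values of `π⁻¹`, and inversion preserves the uniform distribution.
    have hinv : ∑ π : Equiv.Perm (Fin n), F (π.symm m') (π.symm m) =
        ∑ π : Equiv.Perm (Fin n), F (π m') (π m) :=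
      Equiv.sum_comp (Equiv.inv (Equiv.Perm (Fin n)))
        (fun π : Equiv.Perm (Fin n) => F (π m') (π m))
    have hcount := Equiv.Perm.sum_apply_pair F (Finset.ne_of_mem_erase hmm')
    have hcard : ∑ p ∈ (univ : Finset (Fin n)).offDiag, F p.1 p.2 = r * (n - r) := by
      rw [Finset.sum_ite, Finset.sum_const_zero, add_zero, Finset.sum_const, nsmul_eq_mul, mul_one]
      have : (univ : Finset (Fin n)).offDiag.filter
          (fun p => (p.1 : ℕ) < r ∧ r ≤ (p.2 : ℕ)) =
          (univ.filter fun k : Fin n => (k : ℕ) < r) ×ˢ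
            (univ.filter fun k : Fin n => ¬ (k : ℕ) < r) := by
        ext ⟨k, l⟩
        simp only [mem_filter, mem_offDiag, mem_univ, true_and, mem_product, not_lt]
        refine ⟨fun h => h.2, fun h => ⟨fun e => ?_, h⟩⟩
        rw [e] at h
        omega
      have hc := Finset.card_filter_add_card_filter_not (s := (univ : Finset (Fin n)))
        (fun k : Fin n => (k : ℕ) < r)
      rw [this, Finset.card_product]
      rw [Fin.card_filter_val_lt, min_eq_right hrn, Finset.card_univ, Fintype.card_fin] at hc
      rw [Fin.card_filter_val_lt, min_eq_right hrn, Nat.cast_mul]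
      refine congrArg _ (eq_sub_of_add_eq' ?_)
      exact_mod_cast hc
    have hsum := Finset.sum_le_sum fun π (_ : π ∈ (univ : Finset (Equiv.Perm (Fin n)))) => hpt π
    rw [← Finset.sum_mul, hinv] at hsum
    refine le_trans ?_ hsum
    have hfl := mul_pred_le_of_floor_div_exp_one hn3
    rw [← hr] at hfl
    rw [hcard] at hcount
    have hn3' : (3 : ℝ) ≤ n := by exact_mod_cast hn3
    have hpos : (0 : ℝ) < n * (n - 1) := mul_pos hn0 (by linarith)
    have hfac : (0 : ℝ) ≤ n.factorial := Nat.cast_nonneg _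
    have hfifth : (n.factorial : ℝ) / 5 ≤ ∑ π : Equiv.Perm (Fin n), F (π m') (π m) := by
      refine le_of_mul_le_mul_left ?_ hpos
      rw [hcount]
      nlinarith [mul_le_mul_of_nonneg_left hfl hfac]
    calc n.factorial * (I.value {i} / 5) = n.factorial / 5 * I.value {i} := by ring
      _ ≤ _ := mul_le_mul hfifth him (I.value_nonneg _) (le_trans (by positivity) hfifth)
  -- Here `n ≤ 2 < e`: nobody is sampled, and the first arrival is the given agent with probability
  -- `1/n ≥ 1/2`.
  · have hfl : ⌊(n : ℝ) / Real.exp 1⌋₊ = 0 := by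
      rw [Nat.floor_eq_zero, div_lt_one (Real.exp_pos 1)]
      have : (n : ℝ) ≤ 2 := by exact_mod_cast (by omega : n ≤ 2)
      linarith [Real.exp_one_gt_d9]
    simp only [winners_dynkin_of_floor_eq_zero hn hfl]
    have h1 := Equiv.Perm.sum_apply (fun j => I.value {j}) ⟨0, hn⟩
    have h2 : I.value {i} ≤ ∑ j, I.value {j} :=
      Finset.single_le_sum (f := fun j => I.value {j}) (fun j _ => I.value_nonneg _) (mem_univ i)
    have h3 : (n.factorial : ℝ) * I.value {i} ≤ n.factorial * ∑ j, I.value {j} :=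
      mul_le_mul_of_nonneg_left h2 (Nat.cast_nonneg _)
    have h4 : 0 ≤ ∑ π : Equiv.Perm (Fin n), I.value {π ⟨0, hn⟩} :=
      Finset.sum_nonneg fun π _ => I.value_nonneg _
    have h5 : (n : ℝ) ≤ 2 := by exact_mod_cast (by omega : n ≤ 2)
    nlinarith

/-! ### The sampling branch and the combination of both branches -/

theorem opt_eq_zero_of_forall_value_singleton (hs : IsSubmodular I.value)
    (h : ∀ i, I.value {i} ≤ 0) : I.opt = 0 := by
  obtain ⟨S, -, hS⟩ := I.exists_isFeasible_value_eq_opt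
  have h1 := hs.value_union_le ∅ S
  have h2 : ∑ i ∈ S \ ∅, marginalValue I.value i ∅ ≤ 0 := Finset.sum_nonpos fun i _ =>
    (hs.marginalValue_le I.value_empty I.value_nonneg i ∅).trans (h i)
  rw [Finset.empty_union, I.value_empty, hS] at h1
  linarith [I.opt_nonneg]

/-- If `f ≥ t - x`, the bound is immediate. If `f ≥ V - W - t ≥ 0.67 V - W`, then with `D = W / V -
0.4` it suffices that `1.17064 D - 0.141744 ≤ 2.42 D²`; the discriminant requires a coefficient of
about `2.417`, whence `2.42`. -/
theorem sample_tradeoff {V W x a t f : ℝ} (hV : 0 < V) (hx : 0 ≤ x) (ha : a ≤ 0.06 * V)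
    (hat : a + 0.17064 * W ≤ t) (ht : t ≤ 0.33 * V) (hf0 : 0 ≤ f)
    (hf : min (t - x) (V - W - t) ≤ f) :
    V * (a + 0.17064 * W - x) - 2.42 * (W - 0.4 * V) ^ 2 ≤ V * f := by
  rcases le_or_gt W (0.67 * V) with hW | hW
  · rcases min_le_iff.1 hf with h | h
    · nlinarith [mul_le_mul_of_nonneg_left h hV.le, mul_le_mul_of_nonneg_left hat hV.le,
        sq_nonneg (W - 0.4 * V)]
    · nlinarith [mul_le_mul_of_nonneg_left h hV.le, mul_le_mul_of_nonneg_left ha hV.le,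
        mul_le_mul_of_nonneg_left ht hV.le, mul_nonneg hV.le hx,
        sq_nonneg (4.84 * (W - 0.4 * V) - 1.17064 * V), sq_nonneg V]
  · nlinarith [mul_nonneg hV.le hf0, mul_le_mul_of_nonneg_left ha hV.le, mul_nonneg hV.le hx,
      mul_nonneg hV.le (sub_nonneg.2 hW.le), sq_nonneg (W - 0.67 * V)]

/-- The parameters of the theorem. -/
abbrev tunedParameters : MechanismParameters := ⟨0.68, 0.06, 0.27, 2.5⟩

/-- This is `sample_tradeoff` with `a = 0.06 ω` and `W = w(N₁)`. The constant `0.17064` is `0.27 *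
0.632`, where `0.632 ≤ 1 - 1/e`; and `t ≤ 0.33 V` because `ω` and `v(T₁)` are at most `V`. -/
theorem le_value_samplingBranch (hm : Monotone I.value) (hs : IsSubmodular I.value)
    {solve : Finset (Fin n) → Finset (Fin n)} (hsolve : I.IsApproxSolver solve) {ω x : ℝ}
    (hω : 0 < ω) (hωV : ω ≤ I.opt) (hx0 : 0 ≤ x) (hx : ∀ i, I.value {i} ≤ x)
    {S : Finset (Fin n)} (hS : I.IsFeasible S) (hSV : I.value S = I.opt) {w : Fin n → ℝ}
    (hw0 : ∀ i, 0 ≤ w i) (hwS : ∀ i, i ∉ S → w i = 0) (hsum : ∑ i ∈ S, w i = I.value S)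
    (hle : ∀ R, R ⊆ S → ∑ i ∈ R, w i ≤ I.value R) (π : Equiv.Perm (Fin n)) (ξ : ℕ) :
    I.opt * (0.06 * ω +
        0.17064 * (∑ k ∈ univ.filter (fun k : Fin n => (k : ℕ) < ξ), w (π k)) - x) -
      2.42 * (∑ k ∈ univ.filter (fun k : Fin n => (k : ℕ) < ξ), w (π k) - 0.4 * I.opt) ^ 2 ≤
      I.opt * I.value (I.samplingBranch tunedParameters solve ω π ξ).winners := by
  rw [← sum_toFinset_take_arrivals]
  unfold samplingBranch
  dsimp only
  set N := ((arrivals π).take ξ).toFinset with hN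
  have hinter : ∑ i ∈ N, w i = ∑ i ∈ S ∩ N, w i :=
    (Finset.sum_subset Finset.inter_subset_right fun i hi hi' =>
      hwS i fun h => hi' (Finset.mem_inter.2 ⟨h, hi⟩)).symm
  have hsdiff : ∑ i ∈ S \ N, w i + ∑ i ∈ S ∩ N, w i = I.opt := by
    rw [← hSV, ← hsum, ← Finset.sum_inter_add_sum_sdiff S N w, add_comm]
  have hW0 : 0 ≤ ∑ i ∈ N, w i := Finset.sum_nonneg fun i _ => hw0 i
  obtain ⟨-, hTf, hT⟩ := hsolve N
  have hTV : I.value (solve N) ≤ I.opt := I.value_le_optOn (Finset.subset_univ _) hTf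
  have hWN : ∑ i ∈ N, w i ≤ I.optOn N := hinter ▸ (hle _ Finset.inter_subset_left).trans
    (I.value_le_optOn Finset.inter_subset_right (I.isFeasible_mono Finset.inter_subset_left hS))
  have he : (0.632 : ℝ) ≤ 1 - 1 / Real.exp 1 := by
    have : 1 / Real.exp 1 ≤ 0.368 := by
      rw [div_le_iff₀ (Real.exp_pos 1)]
      linarith [Real.exp_one_gt_d9]
    linarith
  have hTW : 0.632 * ∑ i ∈ N, w i ≤ I.value (solve N) :=
    (mul_le_mul he hWN hW0 (le_trans (by norm_num) he)).trans hT
  have hpost := value_le_of_posted_prices hm hs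
    (t := 0.06 * ω + 0.27 * I.value (solve N)) (by nlinarith [I.value_nonneg (solve N)]) hx
    ((arrivals π).drop ξ) (R := S \ N) (I.isFeasible_mono Finset.sdiff_subset hS) (by
      intro i hi
      have := (Finset.mem_sdiff.1 hi).2
      rw [hN, List.mem_toFinset, mem_take_arrivals] at this
      rw [mem_drop_arrivals]
      omega)
  refine sample_tradeoff (t := 0.06 * ω + 0.27 * I.value (solve N)) (hω.trans_le hωV) hx0
    (by linarith) (by linarith) (by linarith) (I.value_nonneg _) (le_trans ?_ hpost)
  exact min_le_min le_rfl (by linarith [hle _ (Finset.sdiff_subset (s := S) (t := N))])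

/-- Averaging the pointwise bound gives `0.068256 = 0.17064 * 0.4` from the mean and `1.5808 = 1 +
2.42 * 0.24` from the variance. -/
theorem le_sum_value_samplingBranch (hm : Monotone I.value) (hs : IsSubmodular I.value)
    {solve : Finset (Fin n) → Finset (Fin n)} (hsolve : I.IsApproxSolver solve) {ω x : ℝ}
    (hω : 0 < ω) (hωV : ω ≤ I.opt) (hx0 : 0 ≤ x) (hx : ∀ i, I.value {i} ≤ x) :
    n.factorial * (0.06 * ω + 0.068256 * I.opt - 1.5808 * x) ≤
      ∑ π : Equiv.Perm (Fin n), ∑ ξ ∈ range (n + 1),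
        ((n.choose ξ : ℝ) * 0.4 ^ ξ * (1 - 0.4) ^ (n - ξ)) *
          I.value (I.samplingBranch tunedParameters solve ω π ξ).winners := by
  have hV : 0 < I.opt := hω.trans_le hωV
  obtain ⟨S, hS, hSV⟩ := I.exists_isFeasible_value_eq_opt
  obtain ⟨w, hw0, hwS, hwv, hsum, hle⟩ := hs.exists_additive_le hm I.value_empty I.value_nonneg S
  have hsumV : ∑ i, w i = I.opt := by
    rw [← hSV, ← hsum]
    exact (Finset.sum_subset (Finset.subset_univ S) fun i _ hi => hwS i hi).symm
  -- This controls the variance `0.24 * ∑ w i ^ 2`, using `w i ≤ v(i) ≤ x`.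
  have hsq : ∑ i, w i ^ 2 ≤ x * I.opt := by
    rw [← hsumV, Finset.mul_sum]
    exact Finset.sum_le_sum fun i _ => by nlinarith [hw0 i, hwv i, hx i]
  refine le_of_mul_le_mul_left ?_ hV
  set V := I.opt with hVdef
  have hfac : (0 : ℝ) ≤ n.factorial := Nat.cast_nonneg _
  have h1 := sum_perm_sum_binomial_prefix 0.4 w
  have h2 := sum_perm_sum_binomial_prefix_sq 0.4 w
  -- The square `(W - 0.4 V)²` is expanded so that the two moment formulas apply.
  have hpt : ∑ π : Equiv.Perm (Fin n), ∑ ξ ∈ range (n + 1),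
      (((n.choose ξ : ℝ) * 0.4 ^ ξ * (1 - 0.4) ^ (n - ξ)) *
        (V * (0.06 * ω - x) - 2.42 * 0.16 * V ^ 2) +
      (0.17064 * V + 2.42 * 0.8 * V) * (((n.choose ξ : ℝ) * 0.4 ^ ξ * (1 - 0.4) ^ (n - ξ)) *
        ∑ k ∈ univ.filter (fun k : Fin n => (k : ℕ) < ξ), w (π k)) -
      2.42 * (((n.choose ξ : ℝ) * 0.4 ^ ξ * (1 - 0.4) ^ (n - ξ)) *
        (∑ k ∈ univ.filter (fun k : Fin n => (k : ℕ) < ξ), w (π k)) ^ 2)) ≤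
      ∑ π : Equiv.Perm (Fin n), ∑ ξ ∈ range (n + 1),
        V * (((n.choose ξ : ℝ) * 0.4 ^ ξ * (1 - 0.4) ^ (n - ξ)) *
          I.value (I.samplingBranch tunedParameters solve ω π ξ).winners) := by
    refine Finset.sum_le_sum fun π _ => Finset.sum_le_sum fun ξ _ => ?_
    have hb : (0 : ℝ) ≤ (n.choose ξ : ℝ) * 0.4 ^ ξ * (1 - 0.4) ^ (n - ξ) := by
      have : (0 : ℝ) ≤ 1 - 0.4 := by norm_num
      positivity
    have := mul_le_mul_of_nonneg_left (le_value_samplingBranch hm hs hsolve hω hωV hx0 hx hS hSV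
      hw0 hwS hsum hle π ξ) hb
    rw [← hVdef] at this
    linarith
  simp only [Finset.sum_add_distrib, Finset.sum_sub_distrib, ← Finset.mul_sum,
    ← Finset.sum_mul] at hpt h1 h2 ⊢
  simp only [sum_binomial, one_mul, Finset.sum_const, Finset.card_univ, Fintype.card_perm,
    Fintype.card_fin, nsmul_eq_mul] at hpt
  rw [h1, h2, hsumV] at hpt
  refine le_trans ?_ hpt
  nlinarith [mul_le_mul_of_nonneg_left hsq hfac]

/-- The guarantee of the mechanism in terms of the largest value `x` of a single agent. -/
theorem exists_le_expectedValue (hm : Monotone I.value) (hs : IsSubmodular I.value)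
    (rank : Equiv.Perm (Fin n)) {solve : Finset (Fin n) → Finset (Fin n)}
    (hsolve : I.IsApproxSolver solve) {ω : ℝ} (hω : 0 < ω) (hωV : ω ≤ I.opt) :
    ∃ x, 0 ≤ x ∧ 0.136 * x ≤ I.expectedValue tunedParameters rank solve ω ∧
      0.136 * x + 0.32 * (0.06 * ω + 0.068256 * I.opt - 1.5808 * x) ≤
        I.expectedValue tunedParameters rank solve ω := by
  have hne : Nonempty (Fin n) := by
    by_contra h
    rw [not_nonempty_iff] at h
    exact (hω.trans_le hωV).ne' (opt_eq_zero_of_forall_value_singleton hs fun i => h.elim i)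
  obtain ⟨i, -, hi⟩ := Finset.exists_max_image univ (fun i => I.value {i})
    (Finset.univ_nonempty (α := Fin n))
  have hd := le_sum_value_dynkin (I := I) rank i
  have hsb := le_sum_value_samplingBranch hm hs hsolve hω hωV (I.value_nonneg {i})
    (fun j => hi j (mem_univ j))
  have hfac : (0 : ℝ) < n.factorial := by positivity
  have hsb0 : 0 ≤ ∑ π : Equiv.Perm (Fin n), ∑ ξ ∈ range (n + 1),
      ((n.choose ξ : ℝ) * 0.4 ^ ξ * (1 - 0.4) ^ (n - ξ)) *
        I.value (I.samplingBranch tunedParameters solve ω π ξ).winners := by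
    refine Finset.sum_nonneg fun π _ => Finset.sum_nonneg fun ξ _ => mul_nonneg ?_ (I.value_nonneg _)
    have : (0 : ℝ) ≤ 1 - 0.4 := by norm_num
    positivity
  have hE : I.expectedValue tunedParameters rank solve ω =
      (0.68 * ∑ π : Equiv.Perm (Fin n), I.value (I.dynkin rank π).winners +
        0.32 * ∑ π : Equiv.Perm (Fin n), ∑ ξ ∈ range (n + 1),
          ((n.choose ξ : ℝ) * 0.4 ^ ξ * (1 - 0.4) ^ (n - ξ)) *
            I.value (I.samplingBranch tunedParameters solve ω π ξ).winners) / n.factorial := by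
    unfold expectedValue
    rw [Finset.mul_sum, Finset.mul_sum, ← Finset.sum_add_distrib]
    norm_num
  -- `0.136 = 0.68 / 5`; the first bound discards the sampling branch.
  refine ⟨I.value {i}, I.value_nonneg _, ?_, ?_⟩ <;> rw [hE, le_div_iff₀ hfac] <;> linarith

end ProcurementInstance

theorem mainTheorem5 :
    (MechanismParameters.mk (q := 0.68) (a := 0.06) (β := 0.27) (k := 2.5)).IsConsistent 95 ∧
    (MechanismParameters.mk (q := 0.68) (a := 0.06) (β := 0.27) (k := 2.5)).IsRobust 280 := by
  constructor
  · rintro n I hm hs rank solve hsolve ω rfl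
    -- If the optimum is zero then so is `ω`, and the sampling bound, which needs `ω > 0`, does not
    -- apply; nonnegativity suffices.
    rcases I.opt_nonneg.eq_or_lt with h0 | hpos
    · rw [← h0]
      refine mul_nonneg (by norm_num) (div_nonneg (Finset.sum_nonneg fun π _ => ?_)
        (Nat.cast_nonneg _))
      refine add_nonneg (mul_nonneg (by norm_num) (I.value_nonneg _)) (mul_nonneg (by norm_num)
        (Finset.sum_nonneg fun ξ _ => mul_nonneg ?_ (I.value_nonneg _)))
      have : (0 : ℝ) ≤ 1 - 1 / 2.5 := by norm_num
      positivity
    · obtain ⟨x, hx, h1, h2⟩ :=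
        ProcurementInstance.exists_le_expectedValue hm hs rank hsolve hpos le_rfl
      change I.opt ≤ 95 * I.expectedValue ProcurementInstance.tunedParameters rank solve I.opt
      -- Weights of about `0.731` on `h1` and `0.269` on `h2` cancel `x`; the resulting ratio is
      -- about `90.7`.
      linarith
  · intro n I hm hs rank solve hsolve ω hω hωV
    obtain ⟨x, hx, h1, h2⟩ :=
      ProcurementInstance.exists_le_expectedValue hm hs rank hsolve hω hωV
    change I.opt ≤ 280 * I.expectedValue ProcurementInstance.tunedParameters rank solve ω
    -- The same weights, with the `ω` term dropped, give a ratio of about `170.3`.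
    linarith
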